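/- Fix a countably infinite set of labels. \emph{Source calculi.} Types are $A,B ::= \alpha \mid A\to B \mid [\ell_i:A_i]_i$, where $\alpha$ ranges over base types and a variant type $[R]$ is given by a finite row $R$, i.e. a finite partial map from labels to types. Terms are those of the Church-style simply typed $\lambda$-calculus together with injections $(\ell\,M)^{[R]}$, case splits $\mathsf{case}\ M\ \{\ell_i\,x_i\mapsto N_i\}_i$ and explicit upcasts $M\rhd B$, with the rules: $(\ell\,M)^{[R]}:[R]$ if $M:A$ and $(\ell:A)\in R$; $\mathsf{case}\ M\ \{\ell_i\,x_i\mapsto N_i\}_i:B$ if $M:[\ell_i:A_i]_i$ and $N_i:B$ under $x_i:A_i$ for all $i$; $M\rhd B:B$ if $M:A$ and $A\leqslant B$. Type annotations are well-kinded, i.e. mention only base types in the kind environment $\Delta$. In $\lambda_{[]}^{\leqslant\mathrm{co}}$ (strictly covariant subtyping) $\leqslant$ is generated by: $\alpha\leqslant\alpha$; $A\to B\leqslant A\to B'$ if $B\leqslant B'$; $[R]\leqslant[R']$ if $\mathrm{dom}\,R\subseteq\mathrm{dom}\,R'$ and $A\leqslant A'$ whenever $(\ell:A)\in R$ and $(\ell:A')\in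 R'$. In $\lambda_{[]}^{\leqslant\mathrm{full}}$ (full subtyping) the function rule is instead: $A\to B\leqslant A'\to B'$ if $A'\leqslant A$ and $B\leqslant B'$. \emph{Target calculus} $\lambda_{[]}^{\rho\theta}$. There are no upcasts. Each field $\ell^P:A$ of a row carries a presence $P ::= \circ\mid\bullet\mid\theta$ (absent, present, or a presence variable), and a row may end in a row variable $\rho$. A row has kind $\mathsf{Row}_{\mathcal L}$ ($\mathcal L$ a finite set of labels) if its labels are distinct and outside $\mathcal L$, its components are well-kinded, and its tail variable, if any, has kind $\mathsf{Row}_{\mathcal L'}$ with $\mathcal L'$ the union of $\mathcal L$ and the labels of the row; variant types are given by rows of kind $\mathsf{Row}_\emptyset$. There are types $\forall\rho^{K}.A$ (for $K=\mathsf{Row}_{\mathcal L}$) and $\forall\theta.A$, with the usual System F abstractions $\Lambda\rho^K.M$, $\Lambda\theta.M$ and applications $M\,R$, $M\,P$. Injection with $\ell$ at type $[R]$ requires $(\ell^\bullet:A)\in R$, and a case split requires a scrutinee of closed type $[\ell_i^{P_i}:A_i]_i$. Types are identified up to reordering of labels and up to absent labels. \emph{Encodings.} A \emph{global type-only encoding}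 of a source calculus in $\lambda_{[]}^{\rho\theta}$ consists of a translation $[\![-]\!]$ of types to types and a translation $[\![-]\!]$ of typing derivations to terms such that \begin{itemize} \item (kind and type preservation) if $\Delta\vdash A$ then $\Delta\vdash[\![A]\!]$, and every derivation of $\Delta;\Gamma\vdash M:A$ with $\Gamma$ well-kinded in $\Delta$ is translated to a term $[\![M]\!]$ with $\Delta;[\![\Gamma]\!]\vdash[\![M]\!]:[\![A]\!]$, where $[\![\Gamma]\!]$ translates the types in $\Gamma$ pointwise; \item (type-only) $[\![M]\!]$ is $M$ up to upcasts, type (i.e. row and presence) abstractions, type applications and type annotations; that is, $M$ and $[\![M]\!]$ have the same type erasure. \end{itemize} Every construct may be translated non-trivially, and the translation of terms may even depend on the whole derivation; in particular all compositional translations of this kind are included. \textbf{Theorem.} There exists no global type-only encoding of $\lambda_{[]}^{\leqslant\mathrm{co}}$ in $\lambda_{[]}^{\rho\theta}$, and there exists no global type-only encoding of $\lambda_{[]}^{\leqslant\mathrm{full}}$ in $\lambda_{[]}^{\rho\theta}$. -/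

import Mathlib

/-! Labels form a countably infinite set.  A row is a finite map on labels, so rows are
identified up to reordering and never repeat a label.  All variable binding uses de Bruijn
indices; row variables, presence variables and term variables are indexed separately. -/

namespace VarSub

abbrev Label := ℕ

/-- Untyped terms with variants, the target of type erasure. A case split has one branch,
binding one variable, for every label of a finite set. -/
inductive UTm : Type
  | var (n : ℕ)
  | lam (M : UTm)
  | app (M N : UTm)
  | inj (l : Label) (M : UTm)
  | case (M : UTm) (L : Finset Label) (N : L → UTm)

/-! ### The source calculi: variants with explicit upcasts -/

/-- Source types: base types, function types and variant types `[l : f l]` for `l ∈ L`. -/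
inductive STy : Type
  | base (a : ℕ)
  | arr (A B : STy)
  | variant (L : Finset Label) (f : L → STy)

/-- Kinding `Δ ⊢ A : Type`, where `Δ` is the set of base types in scope. -/
def STy.WK (Δ : Finset ℕ) : STy → Prop
  | .base a => a ∈ Δ
  | .arr A B => A.WK Δ ∧ B.WK Δ
  | .variant _ f => ∀ l, (f l).WK Δ

/-- Strictly covariant subtyping. -/
inductive CoSub : STy → STy → Prop
  | base (a : ℕ) : CoSub (.base a) (.base a)
  | arr {A B B' : STy} : CoSub B B' → CoSub (.arr A B) (.arr A B')
  | variant {L L' : Finset Label} {f : L → STy} {f' : L' → STy} (h : L ⊆ L') :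
      (∀ l : L, CoSub (f l) (f' ⟨l.1, h l.2⟩)) → CoSub (.variant L f) (.variant L' f')

/-- Full subtyping: contravariant in function parameters. -/
inductive FullSub : STy → STy → Prop
  | base (a : ℕ) : FullSub (.base a) (.base a)
  | arr {A A' B B' : STy} : FullSub A' A → FullSub B B' → FullSub (.arr A B) (.arr A' B')
  | variant {L L' : Finset Label} {f : L → STy} {f' : L' → STy} (h : L ⊆ L') :
      (∀ l : L, FullSub (f l) (f' ⟨l.1, h l.2⟩)) → FullSub (.variant L f) (.variant L' f')

/-- Source terms; `up M A` is the upcast of `M` to `A`. -/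
inductive STm : Type
  | var (n : ℕ)
  | lam (A : STy) (M : STm)
  | app (M N : STm)
  | inj (l : Label) (M : STm) (A : STy)
  | case (M : STm) (L : Finset Label) (N : L → STm)
  | up (M : STm) (A : STy)

/-- Type erasure of source terms: upcasts and annotations disappear. -/
def STm.erase : STm → UTm
  | .var n => .var n
  | .lam _ M => .lam M.erase
  | .app M N => .app M.erase N.erase
  | .inj l M _ => .inj l M.erase
  | .case M L N => .case M.erase L (fun l => (N l).erase)
  | .up M _ => M.erase

/-- Typing derivations `Δ; Γ ⊢ M : A` of the source calculus with subtyping relation `sub`. -/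
inductive SDer (sub : STy → STy → Prop) (Δ : Finset ℕ) : List STy → STm → STy → Type
  | var {Γ : List STy} {n : ℕ} {A : STy} (h : Γ[n]? = some A) : SDer sub Δ Γ (.var n) A
  | lam {Γ : List STy} {A B : STy} {M : STm} (hA : A.WK Δ) (d : SDer sub Δ (A :: Γ) M B) :
      SDer sub Δ Γ (.lam A M) (.arr A B)
  | app {Γ : List STy} {A B : STy} {M N : STm} (d : SDer sub Δ Γ M (.arr A B))
      (e : SDer sub Δ Γ N A) : SDer sub Δ Γ (.app M N) B
  | inj {Γ : List STy} {L : Finset Label} {f : L → STy} {M : STm} (l : L)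
      (hR : (STy.variant L f).WK Δ) (d : SDer sub Δ Γ M (f l)) :
      SDer sub Δ Γ (.inj l M (.variant L f)) (.variant L f)
  | case {Γ : List STy} {L : Finset Label} {f : L → STy} {M : STm} {N : L → STm} {B : STy}
      (hB : B.WK Δ) (d : SDer sub Δ Γ M (.variant L f))
      (e : ∀ l : L, SDer sub Δ (f l :: Γ) (N l) B) : SDer sub Δ Γ (.case M L N) B
  | up {Γ : List STy} {A B : STy} {M : STm} (hB : B.WK Δ) (d : SDer sub Δ Γ M A)
      (h : sub A B) : SDer sub Δ Γ (.up M B) B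

/-! ### The target calculus: variants with row and presence polymorphism -/

/-- Presence types: absent, present, or a presence variable. -/
inductive Pres : Type
  | absent
  | present
  | var (n : ℕ)

/-- Target types. `variant L p f t` is the variant type whose row maps each `l ∈ L` to the
type `f l` with presence `p l`; its tail `t` is empty or a row variable. `allRow K A` is
quantification over a row variable of kind `Row_K`, and `allPre A` over a presence variable. -/
inductive TTy : Type
  | base (a : ℕ)
  | arr (A B : TTy)
  | variant (L : Finset Label) (p : L → Pres) (f : L → TTy) (t : Option ℕ)
  | allRow (K : Finset Label) (A : TTy)
  | allPre (A : TTy)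

/-- Target rows (not necessarily complete). -/
structure TRow : Type where
  dom : Finset Label
  pres : dom → Pres
  ty : dom → TTy
  tail : Option ℕ

/-- The variant type given by a row. -/
def TRow.toTy (R : TRow) : TTy := .variant R.dom R.pres R.ty R.tail

/-- The row consisting of a row variable. -/
def TRow.ofVar (n : ℕ) : TRow :=
  ⟨∅, fun l => absurd l.2 (Finset.notMem_empty _), fun l => absurd l.2 (Finset.notMem_empty _),
    some n⟩

/-- Prefix the fields `(l ^ p l : f l)`, `l ∈ L`, to an optional row. The rows joined in
well-kinded types have disjoint labels. -/
def TRow.extend (L : Finset Label) (p : L → Pres) (f : L → TTy) : Option TRow → TRow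
  | none => ⟨L, p, f, none⟩
  | some R =>
    ⟨L ∪ R.dom,
      fun l => if h : l.1 ∈ L then p ⟨l.1, h⟩
        else R.pres ⟨l.1, (Finset.mem_union.1 l.2).resolve_left h⟩,
      fun l => if h : l.1 ∈ L then f ⟨l.1, h⟩
        else R.ty ⟨l.1, (Finset.mem_union.1 l.2).resolve_left h⟩,
      R.tail⟩

def Pres.subst (s : ℕ → Pres) : Pres → Pres
  | .absent => .absent
  | .present => .present
  | .var n => s n

def Pres.ren (z : ℕ → ℕ) (P : Pres) : Pres := P.subst (fun n => .var (z n))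

/-- Lift a renaming under one binder. -/
def liftRen (x : ℕ → ℕ) : ℕ → ℕ
  | 0 => 0
  | n + 1 => x n + 1

/-- Rename row variables by `x` and presence variables by `z`. -/
def TTy.ren : (ℕ → ℕ) → (ℕ → ℕ) → TTy → TTy
  | _, _, .base a => .base a
  | x, z, .arr A B => .arr (A.ren x z) (B.ren x z)
  | x, z, .variant L p f t =>
    .variant L (fun l => (p l).ren z) (fun l => (f l).ren x z) (t.map x)
  | x, z, .allRow K A => .allRow K (A.ren (liftRen x) z)
  | x, z, .allPre A => .allPre (A.ren x (liftRen z))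

def TRow.ren (x z : ℕ → ℕ) (R : TRow) : TRow :=
  ⟨R.dom, fun l => (R.pres l).ren z, fun l => (R.ty l).ren x z, R.tail.map x⟩

/-- Simultaneous capture-avoiding substitution of rows for row variables and of presences for
presence variables. -/
def TTy.subst : (ℕ → TRow) → (ℕ → Pres) → TTy → TTy
  | _, _, .base a => .base a
  | r, s, .arr A B => .arr (A.subst r s) (B.subst r s)
  | r, s, .variant L p f t =>
    (TRow.extend L (fun l => (p l).subst s) (fun l => (f l).subst r s) (t.map r)).toTy
  | r, s, .allRow K A =>
    .allRow K (A.subst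
      (fun n => match n with
        | 0 => TRow.ofVar 0
        | n + 1 => (r n).ren Nat.succ id) s)
  | r, s, .allPre A =>
    .allPre (A.subst (fun n => (r n).ren id Nat.succ)
      (fun n => match n with
        | 0 => .var 0
        | n + 1 => (s n).ren Nat.succ))

/-- `A[R/ρ]` for the outermost row variable `ρ`. -/
def TTy.instRow (A : TTy) (R : TRow) : TTy :=
  A.subst (fun n => match n with
    | 0 => R
    | n + 1 => TRow.ofVar n) Pres.var

/-- `A[P/θ]` for the outermost presence variable `θ`. -/
def TTy.instPre (A : TTy) (P : Pres) : TTy :=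
  A.subst TRow.ofVar (fun n => match n with
    | 0 => P
    | n + 1 => .var n)

/-- Target kind environments: base types, kinds of the row variables (`K` stands for `Row_K`),
and the number of presence variables in scope. -/
structure TKEnv : Type where
  base : Finset ℕ
  rows : List (Finset Label)
  pres : ℕ

def TKEnv.addRow (D : TKEnv) (K : Finset Label) : TKEnv := { D with rows := K :: D.rows }

def TKEnv.addPre (D : TKEnv) : TKEnv := { D with pres := D.pres + 1 }

/-- Kinding `D ⊢ P : Pre`. -/
def Pres.WK (D : TKEnv) : Pres → Prop
  | .absent => True
  | .present => True
  | .var n => n < D.pres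

/-- Kinding `D ⊢ A : Type`. The row of a variant type is complete (has kind `Row_∅`), so a
tail variable has the kind `Row_L` for the set `L` of labels in front of it. -/
def TTy.WK : TKEnv → TTy → Prop
  | D, .base a => a ∈ D.base
  | D, .arr A B => A.WK D ∧ B.WK D
  | D, .variant L p f t =>
    (∀ l, (p l).WK D) ∧ (∀ l, (f l).WK D) ∧ ∀ n, t = some n → D.rows[n]? = some L
  | D, .allRow K A => A.WK (D.addRow K)
  | D, .allPre A => A.WK D.addPre

/-- Kinding `D ⊢ R : Row_K`. -/
def TRow.WK (D : TKEnv) (K : Finset Label) (R : TRow) : Prop :=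
  Disjoint K R.dom ∧ (∀ l, (R.pres l).WK D) ∧ (∀ l, (R.ty l).WK D) ∧
    ∀ n, R.tail = some n → D.rows[n]? = some (K ∪ R.dom)

/-- The presence of a label among the fields of a row; missing labels count as absent. -/
def presAt (L : Finset Label) (p : L → Pres) (l : Label) : Pres :=
  if h : l ∈ L then p ⟨l, h⟩ else .absent

/-- Type equivalence: absent labels (with their types) are ignored when comparing rows. -/
inductive TEqv : TTy → TTy → Prop
  | base (a : ℕ) : TEqv (.base a) (.base a)
  | arr {A A' B B' : TTy} : TEqv A A' → TEqv B B' → TEqv (.arr A B) (.arr A' B')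
  | variant {L L' : Finset Label} {p : L → Pres} {p' : L' → Pres} {f : L → TTy}
      {f' : L' → TTy} {t : Option ℕ} (hp : ∀ l, presAt L p l = presAt L' p' l)
      (hf : ∀ (l : Label) (h : l ∈ L) (h' : l ∈ L'), p ⟨l, h⟩ ≠ .absent →
        TEqv (f ⟨l, h⟩) (f' ⟨l, h'⟩)) :
      TEqv (.variant L p f t) (.variant L' p' f' t)
  | allRow {K : Finset Label} {A A' : TTy} : TEqv A A' → TEqv (.allRow K A) (.allRow K A')
  | allPre {A A' : TTy} : TEqv A A' → TEqv (.allPre A) (.allPre A')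

/-- Target terms: `rlam`, `rapp`, `plam`, `papp` are abstraction over and application to rows
and presences. -/
inductive TTm : Type
  | var (n : ℕ)
  | lam (A : TTy) (M : TTm)
  | app (M N : TTm)
  | inj (l : Label) (M : TTm) (A : TTy)
  | case (M : TTm) (L : Finset Label) (N : L → TTm)
  | rlam (K : Finset Label) (M : TTm)
  | rapp (M : TTm) (R : TRow)
  | plam (M : TTm)
  | papp (M : TTm) (P : Pres)

/-- Type erasure of target terms: type abstractions, type applications and annotations
disappear. -/
def TTm.erase : TTm → UTm
  | .var n => .var n
  | .lam _ M => .lam M.erase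
  | .app M N => .app M.erase N.erase
  | .inj l M _ => .inj l M.erase
  | .case M L N => .case M.erase L (fun l => (N l).erase)
  | .rlam _ M => M.erase
  | .rapp M _ => M.erase
  | .plam M => M.erase
  | .papp M _ => M.erase

/-- Typing `D; Γ ⊢ M : A` of the target calculus, with types taken up to equivalence. -/
inductive TTyp : TKEnv → List TTy → TTm → TTy → Prop
  | var {D : TKEnv} {Γ : List TTy} {n : ℕ} {A : TTy} : Γ[n]? = some A → TTyp D Γ (.var n) A
  | lam {D : TKEnv} {Γ : List TTy} {A B : TTy} {M : TTm} :
      A.WK D → TTyp D (A :: Γ) M B → TTyp D Γ (.lam A M) (.arr A B)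
  | app {D : TKEnv} {Γ : List TTy} {A B : TTy} {M N : TTm} :
      TTyp D Γ M (.arr A B) → TTyp D Γ N A → TTyp D Γ (.app M N) B
  | inj {D : TKEnv} {Γ : List TTy} {L : Finset Label} {p : L → Pres} {f : L → TTy}
      {t : Option ℕ} {M : TTm} (l : L) :
      (TTy.variant L p f t).WK D → p l = .present → TTyp D Γ M (f l) →
      TTyp D Γ (.inj l M (.variant L p f t)) (.variant L p f t)
  | case {D : TKEnv} {Γ : List TTy} {L : Finset Label} {p : L → Pres} {f : L → TTy}
      {M : TTm} {N : L → TTm} {B : TTy} :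
      B.WK D → TTyp D Γ M (.variant L p f none) → (∀ l : L, TTyp D (f l :: Γ) (N l) B) →
      TTyp D Γ (.case M L N) B
  | rlam {D : TKEnv} {Γ : List TTy} {K : Finset Label} {M : TTm} {A : TTy} :
      TTyp (D.addRow K) (Γ.map (TTy.ren Nat.succ id)) M A →
      TTyp D Γ (.rlam K M) (.allRow K A)
  | rapp {D : TKEnv} {Γ : List TTy} {K : Finset Label} {M : TTm} {A : TTy} {R : TRow} :
      TTyp D Γ M (.allRow K A) → R.WK D K → TTyp D Γ (.rapp M R) (A.instRow R)
  | plam {D : TKEnv} {Γ : List TTy} {M : TTm} {A : TTy} :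
      TTyp D.addPre (Γ.map (TTy.ren id Nat.succ)) M A → TTyp D Γ (.plam M) (.allPre A)
  | papp {D : TKEnv} {Γ : List TTy} {M : TTm} {A : TTy} {P : Pres} :
      TTyp D Γ M (.allPre A) → P.WK D → TTyp D Γ (.papp M P) (A.instPre P)
  | conv {D : TKEnv} {Γ : List TTy} {M : TTm} {A B : TTy} :
      TTyp D Γ M A → TEqv A B → B.WK D → TTyp D Γ M B

/-! ### Type-only encodings -/

/-- The source kind environment `Δ` seen as a target kind environment. -/
def TKEnv.ofBase (Δ : Finset ℕ) : TKEnv := ⟨Δ, [], 0⟩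

/-- A global type-only encoding, in the calculus with row and presence polymorphic variants, of
the variant calculus with subtyping relation `sub`: a translation of types to types and of
typing derivations to terms that preserves kinding and typing (kind environments are kept and
type environments are translated pointwise) and under which every term becomes itself up to
upcasts, type abstractions, type applications and type annotations.

Every construct (base types included) may be translated in a non-trivial way. The translation
of a derivation may depend on the whole derivation; compositional translations, where it is
assembled from the translations of the immediate subderivations, are a special case. -/
structure TypeOnlyEncoding (sub : STy → STy → Prop) where
  ty : STy → TTy
  tm : ∀ {Δ : Finset ℕ} {Γ : List STy} {M : STm} {A : STy}, SDer sub Δ Γ M A → TTm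
  kind_preservation : ∀ (Δ : Finset ℕ) (A : STy), A.WK Δ → (ty A).WK (TKEnv.ofBase Δ)
  type_preservation : ∀ {Δ : Finset ℕ} {Γ : List STy} {M : STm} {A : STy}
    (d : SDer sub Δ Γ M A), (∀ B ∈ Γ, B.WK Δ) →
    TTyp (TKEnv.ofBase Δ) (Γ.map ty) (tm d) (ty A)
  type_only : ∀ {Δ : Finset ℕ} {Γ : List STy} {M : STm} {A : STy} (d : SDer sub Δ Γ M A),
    (tm d).erase = M.erase

end VarSub

namespace VarSub

/-! ### Invariants of target types -/

/-! Width subtyping is used both at top level and below a label `l`, and the two uses make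
incompatible demands on the type `B` that the translation of `[l : []]` gives to the field `l`. For
a label `b` outside the row of `B`, there are two cases (`TTy.exists_boundTail_or_status`).

If the tail of `B` is bound by a quantifier of `B` itself, instantiating outer variables cannot add
`b` (`stable_boundTail`). The upcast of a variable from `[l : []]` to `[l : [b : []]]` erases to the
variable, so the field `l` of the translated target type still lacks `b` (`TTyp.field_of_var`). But
injecting `b` and then `l` forces `b` to be present there (`TTyp.field_of_inj`).

Otherwise the presence of `b` and the tail are fixed from outside the quantifiers of `B`. Splitting
`x : [l : []]` binds a `y` whose type is again of this kind, and `y` is used twice. An empty case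
split on `y` forces `b` to be absent and the row closed; this cannot be undone at the second use,
where `y` is upcast to `[b : []]` (`TTyp.status_of_case_useTwice`). So the translation of `[b : []]`
would lack `b`, yet injection with `b` requires it.

Function types play no role, so one argument covers both subtyping relations. -/

/-- Below its outer quantifiers, the type is a variant with `l` present at a type in `Q`. -/
def TTy.Field (l : Label) (Q : TTy → Prop) : TTy → Prop
  | .base _ => False
  | .arr _ _ => False
  | .variant L p f _ => ∃ h : l ∈ L, p ⟨l, h⟩ = .present ∧ Q (f ⟨l, h⟩)
  | .allRow _ A => A.Field l Q
  | .allPre A => A.Field l Q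

/-- If the type is a variant below its outer quantifiers, then `b` has presence `P` and the row
has tail `t`, both expressed outside these quantifiers. -/
def TTy.Status (b : Label) : Pres → Option ℕ → TTy → Prop
  | _, _, .base _ => True
  | _, _, .arr _ _ => True
  | P, t, .variant L p _ t' => presAt L p b = P ∧ t' = t
  | P, t, .allRow _ A => A.Status b P (t.map Nat.succ)
  | P, t, .allPre A => A.Status b (P.ren Nat.succ) t

/-- Below its outer quantifiers, the type is a variant without `b` whose tail is a row variable
bound by one of these quantifiers or by one of `k` quantifiers around the type. -/
def TTy.BoundTail (b : Label) : ℕ → TTy → Prop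
  | _, .base _ => False
  | _, .arr _ _ => False
  | k, .variant L p _ t => presAt L p b = .absent ∧ ∃ n < k, t = some n
  | k, .allRow _ A => A.BoundTail b (k + 1)
  | k, .allPre A => A.BoundTail b k

/-- Closure under renaming, substitution and equivalence of types. -/
structure Stable (Q : TTy → Prop) : Prop where
  ren : ∀ {A : TTy} (x z : ℕ → ℕ), Q A → Q (A.ren x z)
  subst : ∀ {A : TTy} (r : ℕ → TRow) (s : ℕ → Pres), Q A → Q (A.subst r s)
  eqv : ∀ {A B : TTy}, TEqv A B → Q A → Q B

theorem Stable.true : Stable fun _ => True := ⟨by simp, by simp, by simp⟩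

theorem presAt_mem {L : Finset Label} {p : L → Pres} {l : Label} (h : l ∈ L) :
    presAt L p l = p ⟨l, h⟩ := by
  simp [presAt, h]

theorem presAt_notMem {L : Finset Label} {p : L → Pres} {l : Label} (h : l ∉ L) :
    presAt L p l = .absent := by
  simp [presAt, h]

theorem presAt_eq_present {L : Finset Label} {p : L → Pres} {l : Label}
    (h : presAt L p l = .present) : ∃ h : l ∈ L, p ⟨l, h⟩ = .present := by
  by_cases hl : l ∈ L
  · exact ⟨hl, by rwa [presAt_mem hl] at h⟩
  · simp [presAt_notMem hl] at h

theorem presAt_map {L : Finset Label} {p : L → Pres} (s : ℕ → Pres) (l : Label) :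
    presAt L (fun l => (p l).subst s) l = (presAt L p l).subst s := by
  by_cases h : l ∈ L
  · simp [presAt, h]
  · simp [presAt, h, Pres.subst]

theorem presAt_extend_some {L : Finset Label} {p : L → Pres} {f : L → TTy} {R : TRow}
    (l : Label) :
    presAt (TRow.extend L p f (some R)).dom (TRow.extend L p f (some R)).pres l =
      if l ∈ L then presAt L p l else presAt R.dom R.pres l := by
  by_cases h : l ∈ L
  · simp [TRow.extend, presAt, h]
  · by_cases h' : l ∈ R.dom
    · simp [TRow.extend, presAt, h, h']
    · simp [TRow.extend, presAt, h, h']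

theorem Pres.ren_id (P : Pres) : P.ren id = P := by
  cases P <;> rfl

/-! ### Presence of a field -/

/-- The constant `present` is untouched by substitution, a row substituted for the tail never
overrides the fields in front of it, and equivalence disregards absent labels only. -/
theorem Stable.field {Q : TTy → Prop} (hQ : Stable Q) (l : Label) : Stable (TTy.Field l Q) where
  ren {A} x z h := by
    induction A generalizing x z with
    | base => exact h
    | arr => exact h
    | variant L p f t =>
      obtain ⟨hl, hp, hf⟩ := h
      exact ⟨hl, by simp [hp, Pres.ren, Pres.subst], hQ.ren x z hf⟩
    | allRow K A ih => exact ih _ _ h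
    | allPre A ih => exact ih _ _ h
  subst {A} r s h := by
    induction A generalizing r s with
    | base => exact h
    | arr => exact h
    | variant L p f t =>
      obtain ⟨hl, hp, hf⟩ := h
      cases t with
      | none => exact ⟨hl, by simp [TRow.extend, hp, Pres.subst], hQ.subst r s hf⟩
      | some n =>
        refine ⟨Finset.mem_union_left _ hl, ?_, ?_⟩
        · simp [TRow.extend, hl, hp, Pres.subst]
        · simpa [TRow.extend, hl] using hQ.subst r s hf
    | allRow K A ih => exact ih _ _ h
    | allPre A ih => exact ih _ _ h
  eqv {A B} e h := by
    induction e with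
    | base => exact h
    | arr => exact h
    | @variant L L' p p' f f' t hpp hff _ =>
      obtain ⟨hl, hp, hf⟩ := h
      obtain ⟨hl', hp'⟩ := presAt_eq_present (p := p') (l := l)
        (by rw [← hpp, presAt_mem hl, hp])
      exact ⟨hl', hp', hQ.eqv (hff l hl hl' (by simp [hp])) hf⟩
    | allRow _ ih => exact ih h
    | allPre _ ih => exact ih h

theorem TTy.Field.and {l : Label} {Q Q' : TTy → Prop} {A : TTy} (h : A.Field l Q)
    (h' : A.Field l Q') : A.Field l fun B => Q B ∧ Q' B := by
  induction A with
  | base => exact h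
  | arr => exact h
  | variant => exact ⟨h.1, h.2.1, h.2.2, h'.2.2⟩
  | allRow K A ih => exact ih h h'
  | allPre A ih => exact ih h h'

theorem TTy.Field.exists {l : Label} {Q : TTy → Prop} {A : TTy} (h : A.Field l Q) :
    ∃ B, Q B := by
  induction A with
  | base => exact h.elim
  | arr => exact h.elim
  | variant => exact ⟨_, h.2.2⟩
  | allRow K A ih => exact ih h
  | allPre A ih => exact ih h

/-- Choose a parameter according to the type of the field. -/
theorem TTy.Field.exists_param {l : Label} {Q : TTy → Prop} {Q₁ Q₂ : Label → TTy → Prop} {A : TTy}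
    (h : A.Field l Q) (H : ∀ B, ∃ b, Q₁ b B ∨ Q₂ b B) :
    ∃ b, A.Field l (Q₁ b) ∨ A.Field l (Q₂ b) := by
  induction A with
  | base => exact h.elim
  | arr => exact h.elim
  | variant L p f t =>
    obtain ⟨hl, hp, -⟩ := h
    obtain ⟨b, hb⟩ := H (f ⟨l, hl⟩)
    exact ⟨b, hb.imp (fun hb => ⟨hl, hp, hb⟩) fun hb => ⟨hl, hp, hb⟩⟩
  | allRow K A ih => exact ih h
  | allPre A ih => exact ih h

/-! ### Status of a label -/

theorem TTy.Status.ren {b : Label} {P : Pres} {t : Option ℕ} {A : TTy} (h : A.Status b P t)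
    (x z : ℕ → ℕ) : (A.ren x z).Status b (P.ren z) (t.map x) := by
  induction A generalizing P t x z with
  | base => trivial
  | arr => trivial
  | variant L p f t' =>
    obtain ⟨rfl, rfl⟩ := h
    exact ⟨presAt_map _ _, rfl⟩
  | allRow K A ih =>
    have := ih (P := P) h (liftRen x) z
    simpa [TTy.ren, TTy.Status, Option.map_map, Function.comp_def, liftRen] using this
  | allPre A ih =>
    have := ih h x (liftRen z)
    cases P <;> exact this

theorem TTy.Status.eqv {b : Label} {P : Pres} {t : Option ℕ} {A B : TTy} (e : TEqv A B)
    (h : A.Status b P t) : B.Status b P t := by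
  induction e generalizing P t with
  | base => trivial
  | arr => trivial
  | variant hp => exact ⟨(hp b).symm.trans h.1, h.2⟩
  | allRow _ ih => exact ih h
  | allPre _ ih => exact ih h

/-- The label `b` keeps its presence, up to substitution, unless it is missing from the row and
supplied by the row put in place of the tail. This is the only way in which a missing label can
appear. -/
theorem TTy.Status.subst {b : Label} {P : Pres} {t t' : Option ℕ} {A : TTy} (h : A.Status b P t)
    (r : ℕ → TRow) (s : ℕ → Pres) (ht : t.bind (fun n => (r n).tail) = t') :
    (A.subst r s).Status b (P.subst s) t' ∨
      ∃ n, ∃ hb : b ∈ (r n).dom, t = some n ∧ (A.subst r s).Status b ((r n).pres ⟨b, hb⟩) t' := by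
  subst ht
  induction A generalizing P t r s with
  | base => exact .inl trivial
  | arr => exact .inl trivial
  | variant L p f t' =>
    obtain ⟨rfl, rfl⟩ := h
    cases t' with
    | none => exact .inl ⟨presAt_map _ _, rfl⟩
    | some n =>
      have key := presAt_extend_some (p := fun l => (p l).subst s) (f := fun l => (f l).subst r s)
        (R := r n) b
      by_cases hL : b ∈ L
      · refine .inl ⟨key.trans ?_, rfl⟩
        rw [if_pos hL, presAt_map]
      · rw [if_neg hL] at key
        by_cases hR : b ∈ (r n).dom
        · exact .inr ⟨n, hR, rfl, key.trans (presAt_mem hR), rfl⟩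
        · refine .inl ⟨key.trans ?_, rfl⟩
          rw [presAt_notMem hR, presAt_notMem hL, Pres.subst]
  | allRow K A ih =>
    have := ih (P := P) h (fun n => match n with
        | 0 => TRow.ofVar 0
        | n + 1 => (r n).ren Nat.succ id) s
    cases t with
    | none => simpa [TTy.subst, TTy.Status] using this
    | some n => simpa [TTy.subst, TTy.Status, TRow.ren, Pres.ren_id] using this
  | allPre A ih =>
    have := ih h (fun n => (r n).ren id Nat.succ) (fun n => match n with
        | 0 => .var 0
        | n + 1 => (s n).ren Nat.succ)
    have e : (P.ren Nat.succ).subst (fun n => match n with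
        | 0 => .var 0
        | n + 1 => (s n).ren Nat.succ) = (P.subst s).ren Nat.succ := by cases P <;> rfl
    rw [e] at this
    simpa [TTy.subst, TTy.Status, TRow.ren] using this

theorem TTy.Status.instRow {b : Label} {P : Pres} {t : Option ℕ} {K : Finset Label} {A : TTy}
    (h : (TTy.allRow K A).Status b P t) (R : TRow) : (A.instRow R).Status b P t := by
  have e : P.subst Pres.var = P := P.ren_id
  rcases TTy.Status.subst (A := A) (t := t.map Nat.succ) (t' := t) (P := P) h (fun n => match n with
    | 0 => R
    | n + 1 => TRow.ofVar n) Pres.var (by cases t <;> rfl) with h' | ⟨n, hb, hn, -⟩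
  · rwa [e] at h'
  · cases t with
    | none => simp at hn
    | some m =>
      -- The tail is not the instantiated variable, which has index 0, so the row put in its place
      -- is a bare variable without fields.
      obtain rfl : m + 1 = n := by simpa using hn
      exact absurd hb (Finset.notMem_empty _)

theorem TTy.Status.instPre {b : Label} {P : Pres} {t : Option ℕ} {A : TTy}
    (h : (TTy.allPre A).Status b P t) (Q : Pres) : (A.instPre Q).Status b P t := by
  rcases TTy.Status.subst (A := A) (t' := t) h TRow.ofVar (fun n => match n with
    | 0 => Q
    | n + 1 => .var n) (by cases t <;> rfl) with h' | ⟨n, hb, -⟩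
  · cases P <;> exact h'
  · exact absurd hb (Finset.notMem_empty _)

/-- Only the existence of a status survives substitution; its values may change. This suffices for
the type of a pattern variable, whose scrutinee may have been instantiated. -/
theorem stable_exists_status (b : Label) : Stable fun A => ∃ P t, A.Status b P t where
  ren x z := fun ⟨_, _, h⟩ => ⟨_, _, h.ren x z⟩
  subst r s := fun ⟨_, _, h⟩ => by
    rcases h.subst r s rfl with h' | ⟨_, _, -, h'⟩ <;> exact ⟨_, _, h'⟩
  eqv e := fun ⟨_, _, h⟩ => ⟨_, _, h.eqv e⟩

theorem TTy.Status.not_field {b : Label} {t : Option ℕ} {Q : TTy → Prop} {A : TTy}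
    (h : A.Status b .absent t) : ¬ A.Field b Q := by
  induction A generalizing t with
  | base => exact id
  | arr => exact id
  | variant L p f t' =>
    rintro ⟨hb, hp, -⟩
    have := h.1
    simp [presAt_mem hb, hp] at this
  | allRow K A ih => exact ih h
  | allPre A ih => exact ih h

/-! ### Tails bound inside a type -/

theorem TTy.BoundTail.ren {b : Label} {k : ℕ} {A : TTy} (h : A.BoundTail b k) {x : ℕ → ℕ}
    (z : ℕ → ℕ) (hx : ∀ n < k, x n = n) : (A.ren x z).BoundTail b k := by
  induction A generalizing k x z with
  | base => exact h
  | arr => exact h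
  | variant L p f t =>
    obtain ⟨hp, n, hn, rfl⟩ := h
    refine ⟨(presAt_map _ _).trans (by rw [hp]; rfl), n, hn, by simp [hx n hn]⟩
  | allRow K A ih =>
    refine ih (k := k + 1) h z fun n hn => ?_
    cases n with
    | zero => rfl
    | succ n => simp [liftRen, hx n (by omega)]
  | allPre A ih => exact ih (k := k) h _ hx

/-- Substitution acts as the identity on the tails of the `k` bound variables, so capture avoidance
keeps `b` out of the row. For `k = 0` the condition on `r` is vacuous. -/
theorem TTy.BoundTail.subst {b : Label} {k : ℕ} {A : TTy} (h : A.BoundTail b k) {r : ℕ → TRow}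
    (s : ℕ → Pres) (hr : ∀ n < k, (r n).tail = some n ∧ b ∉ (r n).dom) :
    (A.subst r s).BoundTail b k := by
  induction A generalizing k r s with
  | base => exact h
  | arr => exact h
  | variant L p f t =>
    obtain ⟨hp, n, hn, rfl⟩ := h
    refine ⟨(presAt_extend_some (R := r n) b).trans ?_, n, hn, (hr n hn).1⟩
    rw [presAt_notMem (hr n hn).2, presAt_map, hp]
    exact ite_self _
  | allRow K A ih =>
    refine ih (k := k + 1) h s fun n hn => ?_
    cases n with
    | zero => simp [TRow.ofVar]
    | succ n => simpa [TRow.ren] using hr n (by omega)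
  | allPre A ih =>
    exact ih (k := k) h _ fun n hn => by simpa [TRow.ren] using hr n hn

theorem TTy.BoundTail.eqv {b : Label} {k : ℕ} {A B : TTy} (e : TEqv A B)
    (h : A.BoundTail b k) : B.BoundTail b k := by
  induction e generalizing k with
  | base => exact h
  | arr => exact h
  | variant hp => exact ⟨(hp b).symm.trans h.1, h.2⟩
  | allRow _ ih => exact ih (k := k + 1) h
  | allPre _ ih => exact ih (k := k) h

theorem stable_boundTail (b : Label) : Stable (TTy.BoundTail b 0) where
  ren _ z h := h.ren z (by simp)
  subst _ s h := h.subst s (by simp)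
  eqv e h := h.eqv e

theorem TTy.BoundTail.not_field {b : Label} {k : ℕ} {Q : TTy → Prop} {A : TTy}
    (h : A.BoundTail b k) : ¬ A.Field b Q := by
  induction A generalizing k with
  | base => exact id
  | arr => exact id
  | variant L p f t' =>
    rintro ⟨hb, hp, -⟩
    have := h.1
    simp [presAt_mem hb, hp] at this
  | allRow K A ih => exact ih (k := k + 1) h
  | allPre A ih => exact ih (k := k) h

/-- The set `S` collects the labels of the row below the quantifiers. The tail is then empty, or a
variable that is either bound or free; the offset `k` counts the row quantifiers already crossed. -/
theorem TTy.boundTail_or_status (A : TTy) : ∃ S : Finset Label, ∀ b ∉ S, ∀ k,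
    A.BoundTail b k ∨ A.Status b .absent none ∨ ∃ n, A.Status b .absent (some (n + k)) := by
  induction A with
  | base => exact ⟨∅, fun _ _ _ => .inr (.inl trivial)⟩
  | arr => exact ⟨∅, fun _ _ _ => .inr (.inl trivial)⟩
  | variant L p f t =>
    refine ⟨L, fun b hb k => ?_⟩
    cases t with
    | none => exact .inr (.inl ⟨presAt_notMem hb, rfl⟩)
    | some n =>
      rcases lt_or_ge n k with hn | hn
      · exact .inl ⟨presAt_notMem hb, n, hn, rfl⟩
      · exact .inr (.inr ⟨n - k, presAt_notMem hb, by rw [Nat.sub_add_cancel hn]⟩)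
  | allRow K A ih =>
    obtain ⟨S, hS⟩ := ih
    exact ⟨S, fun b hb k => hS b hb (k + 1)⟩
  | allPre A ih =>
    obtain ⟨S, hS⟩ := ih
    exact ⟨S, fun b hb k => hS b hb k⟩

theorem TTy.exists_boundTail_or_status (A : TTy) :
    ∃ b, A.BoundTail b 0 ∨ ∃ P t, A.Status b P t := by
  obtain ⟨S, hS⟩ := A.boundTail_or_status
  obtain ⟨b, hb⟩ := Infinite.exists_notMem_finset S
  refine ⟨b, (hS b hb 0).imp_right ?_⟩
  rintro (h | ⟨n, h⟩) <;> exact ⟨_, _, h⟩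

/-! ### Types of terms with a given erasure -/

/-- A term erasing to a variable is that variable under type abstractions, type applications and
conversions, all of which respect stable properties. -/
theorem TTyp.field_of_var {Q : TTy → Prop} {l : Label} (hQ : Stable Q) {D : TKEnv}
    {Γ : List TTy} {M : TTm} {A C : TTy} {n : ℕ} (h : TTyp D Γ M A) (hM : M.erase = .var n)
    (hn : Γ[n]? = some C) (hC : C.Field l Q) : A.Field l Q := by
  induction h generalizing C with
  | var h' =>
    obtain rfl : _ = n := by simpa [TTm.erase] using hM
    obtain rfl := Option.some.inj (hn.symm.trans h')
    exact hC
  | lam | app | inj | case => simp [TTm.erase] at hM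
  | rlam _ ih => exact ih hM (by simp [hn]) ((hQ.field l).ren Nat.succ id hC)
  | plam _ ih => exact ih hM (by simp [hn]) ((hQ.field l).ren id Nat.succ hC)
  | @rapp _ _ _ _ A _ _ _ ih =>
    exact (hQ.field l).subst (A := A) _ _ (ih hM hn hC)
  | @papp _ _ _ A _ _ _ ih =>
    exact (hQ.field l).subst (A := A) _ _ (ih hM hn hC)
  | conv _ e _ ih => exact (hQ.field l).eqv e (ih hM hn hC)

/-- Unlike for `TTyp.field_of_var`, the values `P` and `t` are preserved exactly: type application
instantiates only the quantifiers of the type itself, and these do not bind `P` or `t`. -/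
theorem TTyp.status_of_var {b : Label} {P : Pres} {t : Option ℕ} {D : TKEnv}
    {Γ : List TTy} {M : TTm} {A C : TTy} {n : ℕ} (h : TTyp D Γ M A) (hM : M.erase = .var n)
    (hn : Γ[n]? = some C) (hC : C.Status b P t) : A.Status b P t := by
  induction h generalizing C P t with
  | var h' =>
    obtain rfl : _ = n := by simpa [TTm.erase] using hM
    obtain rfl := Option.some.inj (hn.symm.trans h')
    exact hC
  | lam | app | inj | case => simp [TTm.erase] at hM
  | @rlam _ _ _ _ A _ ih =>
    have := ih hM (by simp [hn]) (hC.ren Nat.succ id)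
    rw [Pres.ren_id] at this
    exact this
  | plam _ ih =>
    have := ih hM (by simp [hn]) (hC.ren id Nat.succ)
    rw [Option.map_id] at this
    exact this
  | rapp _ _ ih => exact (ih hM hn hC).instRow _
  | papp _ _ ih => exact (ih hM hn hC).instPre _
  | conv _ e _ ih => exact (ih hM hn hC).eqv e

theorem TTyp.field_of_inj {Q : TTy → Prop} (hQ : Stable Q) {l : Label} {e : UTm}
    (he : ∀ {D Γ N B}, TTyp D Γ N B → N.erase = e → Q B) {D : TKEnv} {Γ : List TTy} {M : TTm}
    {A : TTy} (h : TTyp D Γ M A) (hM : M.erase = .inj l e) : A.Field l Q := by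
  induction h with
  | var | lam | app | case => simp [TTm.erase] at hM
  | inj l' hR hp hN ih =>
    simp only [TTm.erase, UTm.inj.injEq] at hM
    obtain ⟨rfl, hM⟩ := hM
    exact ⟨l'.2, hp, he hN hM⟩
  | rlam _ ih => exact ih hM
  | plam _ ih => exact ih hM
  | @rapp _ _ _ _ A _ _ _ ih => exact (hQ.field l).subst (A := A) _ _ (ih hM)
  | @papp _ _ _ A _ _ _ ih => exact (hQ.field l).subst (A := A) _ _ (ih hM)
  | conv _ e _ ih => exact (hQ.field l).eqv e (ih hM)

/-- A variable can be scrutinised by an empty case split only if all labels are absent and the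
row is closed, unless its type is polymorphic in this respect. -/
theorem TTyp.status_of_case_empty {b : Label} {P : Pres} {t : Option ℕ} {D : TKEnv}
    {Γ : List TTy} {M : TTm} {A C : TTy} {n : ℕ} {N : (∅ : Finset Label) → UTm}
    (h : TTyp D Γ M A) (hM : M.erase = .case (.var n) ∅ N) (hn : Γ[n]? = some C)
    (hC : C.Status b P t) : P = .absent ∧ t = none := by
  induction h generalizing C P t with
  | var | lam | app | inj => simp [TTm.erase] at hM
  | case hB hS hN =>
    simp only [TTm.erase, UTm.case.injEq] at hM
    obtain ⟨hM, rfl, -⟩ := hM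
    obtain ⟨h₁, h₂⟩ := hS.status_of_var hM hn hC
    exact ⟨h₁.symm.trans (presAt_notMem (Finset.notMem_empty b)), h₂.symm⟩
  | rlam _ ih =>
    obtain ⟨h₁, h₂⟩ := ih hM (by simp [hn]) (hC.ren Nat.succ id)
    -- Renaming turns neither a variable nor `present` into `absent`.
    cases P <;> simp_all [Pres.ren, Pres.subst]
  | plam _ ih =>
    obtain ⟨h₁, h₂⟩ := ih hM (by simp [hn]) (hC.ren id Nat.succ)
    cases P <;> simp_all [Pres.ren, Pres.subst]
  | rapp _ _ ih => exact ih hM hn hC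
  | papp _ _ ih => exact ih hM hn hC
  | conv _ _ _ ih => exact ih hM hn hC

/-- A term that scrutinises a variable by an empty case split and then returns it. -/
def useTwice (l : Label) : UTm :=
  .case (.case (.var 0) ∅ fun l => absurd l.2 (Finset.notMem_empty _)) {l} fun _ => .var 1

/-- Both occurrences of the variable share one type in the context, so what the empty split forces
on it also holds where it is returned. -/
theorem TTyp.status_of_useTwice {b l : Label} {P : Pres} {t : Option ℕ} {D : TKEnv}
    {Γ : List TTy} {M : TTm} {A C : TTy} (h : TTyp D Γ M A) (hM : M.erase = useTwice l)
    (hn : Γ[0]? = some C) (hC : C.Status b P t) : A.Status b .absent none := by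
  induction h generalizing C P t with
  | var | lam | app | inj => simp [TTm.erase, useTwice] at hM
  | case hB hS hN =>
    simp only [TTm.erase, useTwice, UTm.case.injEq] at hM
    obtain ⟨hM, rfl, hE⟩ := hM
    obtain ⟨rfl, rfl⟩ := hS.status_of_case_empty hM hn hC
    exact (hN ⟨l, Finset.mem_singleton_self l⟩).status_of_var (congrFun (eq_of_heq hE) _)
      (by simpa using hn) hC
  | rlam _ ih => exact ih hM (by simp [hn]) (hC.ren Nat.succ id)
  | plam _ ih => exact ih hM (by simp [hn]) (hC.ren id Nat.succ)
  -- The kind is irrelevant to `TTy.Status`, so any `K` serves.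
  | rapp _ _ ih => exact TTy.Status.instRow (K := ∅) (t := none) (ih hM hn hC) _
  | papp _ _ ih => exact TTy.Status.instPre (P := .absent) (ih hM hn hC) _
  | conv _ e _ ih => exact (ih hM hn hC).eqv e

theorem TTyp.status_of_case_useTwice {b l : Label} {D : TKEnv} {Γ : List TTy} {M : TTm}
    {A C : TTy} (h : TTyp D Γ M A)
    (hM : M.erase = .case (.var 0) {l} fun _ => useTwice l) (hn : Γ[0]? = some C)
    (hC : C.Field l fun B => ∃ P t, B.Status b P t) : A.Status b .absent none := by
  have hs := (stable_exists_status b).field l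
  induction h generalizing C with
  | var | lam | app | inj => simp [TTm.erase] at hM
  | case hB hS hN =>
    simp only [TTm.erase, UTm.case.injEq] at hM
    obtain ⟨hM, rfl, hE⟩ := hM
    obtain ⟨hl, -, P, t, hPt⟩ := hS.field_of_var (stable_exists_status b) hM hn hC
    exact (hN ⟨l, hl⟩).status_of_useTwice (congrFun (eq_of_heq hE) _) rfl hPt
  | rlam _ ih => exact ih hM (by simp [hn]) (hs.ren Nat.succ id hC)
  | plam _ ih => exact ih hM (by simp [hn]) (hs.ren id Nat.succ hC)
  | rapp _ _ ih => exact TTy.Status.instRow (K := ∅) (t := none) (ih hM hn hC) _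
  | papp _ _ ih => exact TTy.Status.instPre (P := .absent) (ih hM hn hC) _
  | conv _ e _ ih => exact (ih hM hn hC).eqv e

/-! ### Source derivations -/

/-- The empty variant type. -/
def STy.empty : STy := .variant ∅ fun l => absurd l.2 (Finset.notMem_empty _)

/-- The variant type `[l : A]`. -/
def STy.single (l : Label) (A : STy) : STy := .variant {l} fun _ => A

theorem STy.empty_wk (Δ : Finset ℕ) : STy.empty.WK Δ :=
  fun l => absurd l.2 (Finset.notMem_empty _)

theorem STy.WK.single {Δ : Finset ℕ} {A : STy} (h : A.WK Δ) (l : Label) :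
    (STy.single l A).WK Δ :=
  fun _ => h

def SDer.single {sub : STy → STy → Prop} {Δ : Finset ℕ} {Γ : List STy} {A : STy} {M : STm}
    (l : Label) (hA : A.WK Δ) (d : SDer sub Δ Γ M A) :
    SDer sub Δ Γ (.inj l M (.single l A)) (.single l A) :=
  .inj (f := fun _ => A) ⟨l, Finset.mem_singleton_self l⟩ (hA.single l) d

/-- Split the variable of type `[l : []]`, then use its content `y : []` twice: split `y`, and
return the upcast of `y` to `[b : []]`. -/
def SDer.caseUseTwice {sub : STy → STy → Prop} (l b : Label)
    (h : sub .empty (.single b .empty)) :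
    SDer sub ∅ [.single l .empty]
      (.case (.var 0) {l} fun _ => .case
        (.case (.var 0) ∅ fun l => absurd l.2 (Finset.notMem_empty _)) {l} fun _ =>
          .up (.var 1) (.single b .empty))
      (.single b .empty) :=
  have hb : (STy.single b .empty).WK ∅ := (STy.empty_wk ∅).single b
  .case (f := fun _ => .empty) hb (.var rfl) fun _ =>
    .case (f := fun _ => .empty) hb
      (.case ((STy.empty_wk ∅).single l) (.var rfl) fun l => absurd l.2 (Finset.notMem_empty _))
      fun _ => .up hb (.var rfl) h

/-- There is no type-only encoding if width subtyping is available at the top level and inside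
a variant. -/
theorem isEmpty_typeOnlyEncoding {sub : STy → STy → Prop} (l : Label)
    (h₁ : ∀ b, sub .empty (.single b .empty))
    (h₂ : ∀ b, sub (.single l .empty) (.single l (.single b .empty))) :
    IsEmpty (TypeOnlyEncoding sub) := by
  refine ⟨fun E => ?_⟩
  have hw := STy.empty_wk ∅
  have hΓ : ∀ B ∈ [STy.empty], B.WK ∅ := by simpa using hw
  have hΓ' : ∀ B ∈ [STy.single l .empty], B.WK ∅ := by simpa using hw.single l
  have x : SDer sub ∅ [.empty] (.var 0) .empty := .var rfl
  have inj_field : ∀ a, (E.ty (.single a .empty)).Field a fun _ => True := fun a =>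
    (E.type_preservation (x.single a hw) hΓ).field_of_inj .true (fun _ _ => trivial)
      (E.type_only _)
  -- The label `b` is chosen only now, after the translation has fixed the type of the field `l`;
  -- hence the hypotheses quantify over all `b`.
  obtain ⟨b, hb | hb⟩ := (inj_field l).exists_param TTy.exists_boundTail_or_status
  · have up : SDer sub ∅ [.single l .empty] (.up (.var 0) (.single l (.single b .empty))) _ :=
      .up ((hw.single b).single l) (.var rfl) (h₂ b)
    have h := (E.type_preservation up hΓ').field_of_var (stable_boundTail b)
      (E.type_only up) rfl hb
    have h' := (E.type_preservation ((x.single b hw).single l (hw.single b)) hΓ).field_of_inj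
      (Stable.true.field b)
      (fun hN he => hN.field_of_inj .true (fun _ _ => trivial) he) (E.type_only _)
    -- Both facts concern the same type, that of the field `l`.
    obtain ⟨B, h₃, h₄⟩ := (h.and h').exists
    exact h₃.not_field h₄
  · have h := (E.type_preservation (SDer.caseUseTwice l b (h₁ b)) hΓ').status_of_case_useTwice
      ((E.type_only _).trans ?_) rfl hb
    · exact h.not_field (inj_field b)
    · simp only [STm.erase, useTwice]
      congr! 4
      exact funext fun l => absurd l.2 (Finset.notMem_empty _)

end VarSub

theorem mainTheorem2 :
    IsEmpty (VarSub.TypeOnlyEncoding VarSub.CoSub) ∧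
      IsEmpty (VarSub.TypeOnlyEncoding VarSub.FullSub) := by
  open VarSub in
  have h₁ : ∀ b, CoSub .empty (.single b .empty) := fun b =>
    .variant (Finset.empty_subset _) fun l => absurd l.2 (Finset.notMem_empty _)
  have h₂ : ∀ b, FullSub .empty (.single b .empty) := fun b =>
    .variant (Finset.empty_subset _) fun l => absurd l.2 (Finset.notMem_empty _)
  exact ⟨isEmpty_typeOnlyEncoding 0 h₁ fun b => .variant subset_rfl fun _ => h₁ b,
    isEmpty_typeOnlyEncoding 0 h₂ fun b => .variant subset_rfl fun _ => h₂ b⟩
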